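/- Let $N$ and $r$ be integers with $2\le N\le r$, let $\mathcal A,\mathcal B\in\mathbb C^{r\times(r+1)}$, and consider the $(r+1)\times r$ matrix pencil $\widetilde{\mathbb G}(\lambda)=\mathcal A^\top-\lambda\mathcal B^\top$. Assume that $\widetilde{\mathbb G}(\lambda)$ admits a polynomial left inverse, that is, there is an $r\times(r+1)$ matrix $L(\lambda)$ with entries in $\mathbb C[\lambda]$ such that $L(\lambda)\widetilde{\mathbb G}(\lambda)=\mathbf I_r$. Assume moreover that 1. $\operatorname{rank}(\mathcal A^\top)=r$, 2. $\operatorname{rank}(\mathcal B^\top)=N-1$, and 3. $\operatorname{rank}\begin{bmatrix}-\mathcal B&0\\ \mathcal A&-\mathcal B\end{bmatrix}=r+N-1$. Let $\mathsf G_r$ be the $Nr\times(N-1)(r+1)$ block matrix with $N$ block rows and $N-1$ block columns (all blocks of size $r\times(r+1)$) that has $-\mathcal B$ in the blocks $(j,j)$ and $\mathcal A$ in the blocks $(j+1,j)$, $1\le j\le N-1$, and zero blocks elsewhere. For $i=1,\dots,r$ let $e_i$ be the $i$-th column of the identity matrix $\mathbf I_r$. Then, for each $i=1,\dots,r$, the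 linear system $$\mathsf G_r\begin{bmatrix}\boldsymbol\ell_i^{N-2}\\ \boldsymbol\ell_i^{N-3}\\ \vdots\\ \boldsymbol\ell_i^{0}\end{bmatrix}=\begin{bmatrix}\mathbf 0\\ \vdots\\ \mathbf 0\\ e_i\end{bmatrix},\qquad \boldsymbol\ell_i^k\in\mathbb C^{r+1},$$ has a unique solution. Moreover, if $\mathsf L(\lambda)$ denotes the $(r+1)\times r$ polynomial matrix whose $i$-th column is $\mathsf L_i(\lambda)=\boldsymbol\ell_i^0+\boldsymbol\ell_i^1\lambda+\cdots+\boldsymbol\ell_i^{N-2}\lambda^{N-2}$ (so that its entries have degree at most $N-2$), where $(\boldsymbol\ell_i^{N-2},\dots,\boldsymbol\ell_i^0)$ is the solution of the $i$-th system, then $$\mathsf L^\top(\lambda)\,\widetilde{\mathbb G}(\lambda)=\mathbf I_r .$$ -/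

import Mathlib

open Polynomial

namespace PencilLeftInverse

/-- The `(r+1) × r` matrix pencil `𝒜ᵀ - λ ℬᵀ`, as a matrix of polynomials in `λ`
(the variable `X`). -/
noncomputable def pencil {r : ℕ} (A B : Matrix (Fin r) (Fin (r + 1)) ℂ) :
    Matrix (Fin (r + 1)) (Fin r) ℂ[X] :=
  A.transpose.map C - (X : ℂ[X]) • B.transpose.map C

/-- A rectangular polynomial matrix admits a polynomial left inverse. -/
def HasPolynomialLeftInverse {m n : ℕ} (G : Matrix (Fin m) (Fin n) ℂ[X]) : Prop :=
  ∃ L : Matrix (Fin n) (Fin m) ℂ[X], L * G = 1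

/-- The `N r × (N-1)(r+1)` block bidiagonal matrix with `N` block rows and `N-1` block columns,
with `-ℬ` in the diagonal blocks `(j, j)`, with `𝒜` in the subdiagonal blocks `(j+1, j)`, and
with zero blocks elsewhere. A row index is a pair (block row, row inside the block), and
similarly for columns. -/
def blockMatrix {r : ℕ} (N : ℕ) (A B : Matrix (Fin r) (Fin (r + 1)) ℂ) :
    Matrix (Fin N × Fin r) (Fin (N - 1) × Fin (r + 1)) ℂ :=
  Matrix.of fun p q =>
    if (p.1 : ℕ) = q.1 then -B p.2 q.2
    else if (p.1 : ℕ) = q.1 + 1 then A p.2 q.2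
    else 0

/-- The right-hand side `(0, …, 0, e_i)`, with `N` blocks of length `r`; its last block is the
`i`-th column of the identity matrix. -/
def blockRhs {r : ℕ} (N : ℕ) (i : Fin r) : Fin N × Fin r → ℂ :=
  fun p => if (p.1 : ℕ) = N - 1 then (1 : Matrix (Fin r) (Fin r) ℂ) p.2 i else 0

/-- The vector `ℓ^k` contained in the stacked vector `x = (ℓ^{N-2}, ℓ^{N-3}, …, ℓ^0)`:
the block of `x` in position `N-2-k`. -/
def coeffBlock {r N : ℕ} (x : Fin (N - 1) × Fin (r + 1) → ℂ) (k : Fin (N - 1)) :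
    Fin (r + 1) → ℂ :=
  fun b => x (k.rev, b)

/-- The `(r+1) × r` polynomial matrix whose `i`-th column is
`𝖫_i(λ) = ℓ_i^0 + ℓ_i^1 λ + ⋯ + ℓ_i^{N-2} λ^{N-2}`,
where `x i = (ℓ_i^{N-2}, …, ℓ_i^0)`. -/
noncomputable def polyMatrix {r N : ℕ} (x : Fin r → Fin (N - 1) × Fin (r + 1) → ℂ) :
    Matrix (Fin (r + 1)) (Fin r) ℂ[X] :=
  Matrix.of fun b i => ∑ k : Fin (N - 1), C (coeffBlock (x i) k b) * X ^ (k : ℕ)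

end PencilLeftInverse

/-! Read from the bottom up, the block system is the coefficientwise form of `(A - λB) ℓ(λ) = e_i`
with `deg ℓ ≤ N - 2`. Everything thus reduces to a bijectivity statement for `A - λB` on vector
polynomials of bounded degree, `pencilMap_bijective_of_rank`. With `n = N - 2`, its target consists
of the vector polynomials of degree at most `n + 1` whose leading coefficient lies in the range of
`B`. Since `rank B = n + 1`, source and target both have dimension `(n + 1)(r + 1)`, so surjectivity
suffices.

The transposed left inverse solves `(A - λB) ℓ = q` for every `q`, but without control of `deg ℓ`.
If the degree `D` of a solution exceeds `n`, its top coefficient lies in `W = {x | Bx = 0, Ax ∈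
range B}`. The block rank condition gives `dim W ≤ 1` (`exists_smul_of_finrank_ker`). A dimension
count yields a nonzero `p` of degree `e ≤ n + 1` with `(A - λB) p = 0` (`exists_kernel_sequence`),
and its top coefficient spans `W`. Subtracting a multiple of `λ ^ (D - e) p` lowers the degree of
`ℓ`, down to at most `n` (`exists_pencilMap_eq_of_degree_bound`). -/

namespace PencilLeftInverse

/-! ### Linear pencils acting on vector polynomials, given by coefficient sequences. -/

section Sequences

variable {K V U : Type*} [Field K] [AddCommGroup V] [Module K V] [AddCommGroup U] [Module K U]

/-- The action of the pencil `A - λ B` on coefficient sequences of vector polynomials. -/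
def pencilMap (A B : V →ₗ[K] U) : (ℕ → V) →ₗ[K] (ℕ → U) where
  toFun l k := A (l k) - B (if k = 0 then 0 else l (k - 1))
  map_add' l m := by
    ext k
    by_cases hk : k = 0 <;> simp [hk]
    abel
  map_smul' c l := by
    ext k
    by_cases hk : k = 0 <;> simp [hk, smul_sub]

@[simp] lemma pencilMap_zero (A B : V →ₗ[K] U) (l : ℕ → V) : pencilMap A B l 0 = A (l 0) := by
  simp [pencilMap]

@[simp] lemma pencilMap_succ (A B : V →ₗ[K] U) (l : ℕ → V) (k : ℕ) :
    pencilMap A B l (k + 1) = A (l (k + 1)) - B (l k) := by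
  simp [pencilMap]

/-- Multiplication of a vector polynomial by `λ ^ m`, on coefficient sequences. -/
def shiftSeq (m : ℕ) (l : ℕ → V) : ℕ → V := fun k => if k < m then 0 else l (k - m)

lemma pencilMap_shiftSeq_eq_zero (A B : V →ₗ[K] U) (m : ℕ) {p : ℕ → V}
    (hp : pencilMap A B p = 0) : pencilMap A B (shiftSeq m p) = 0 := by
  ext k
  rcases k with _ | k
  · have h0 := congrFun hp 0
    rcases m with _ | m <;> simp_all [shiftSeq]
  · rcases lt_trichotomy (k + 1) m with h | h | h
    · simp [shiftSeq, h, Nat.lt_of_succ_lt h]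
    · have h0 := congrFun hp 0
      simp_all [shiftSeq, ← h]
    · have h0 := congrFun hp (k - m + 1)
      have e : k + 1 - m = k - m + 1 := by omega
      simpa [shiftSeq, h.not_gt, (Nat.lt_succ_iff.mp h).not_gt, e] using h0

/-- Degree reduction: as long as the top index `D` is at least `n`, the coefficient `l D` is
proportional to `p e`, so a shifted multiple of `p` cancels it without changing the image. -/
lemma exists_pencilMap_eq_of_degree_bound (A B : V →ₗ[K] U) {n e : ℕ} (hn : 1 ≤ n) (he : e ≤ n)
    {p : ℕ → V} (hp : pencilMap A B p = 0) (hpe : ∀ k, e < k → p k = 0)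
    (hW : ∀ x, B x = 0 → A x ∈ LinearMap.range B → ∃ c : K, x = c • p e)
    {q : ℕ → U} (hq : ∀ k, n < k → q k = 0) (hqn : q n ∈ LinearMap.range B) (D : ℕ) :
    ∀ l : ℕ → V, pencilMap A B l = q → (∀ k, D ≤ k → l k = 0) →
      ∃ l' : ℕ → V, pencilMap A B l' = q ∧ ∀ k, n ≤ k → l' k = 0 := by
  induction D with
  | zero => exact fun l hl h => ⟨l, hl, fun k _ => h k (Nat.zero_le k)⟩
  | succ D ih =>
    intro l hl h
    rcases Nat.lt_or_ge D n with hD | hD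
    · exact ⟨l, hl, fun k hk => h k (by omega)⟩
    have hB : B (l D) = 0 := by
      have h1 := congrFun hl (D + 1)
      rw [pencilMap_succ, h (D + 1) le_rfl, hq (D + 1) (by omega)] at h1
      simpa using h1
    have hqD : q D ∈ LinearMap.range B := by
      rcases hD.eq_or_lt with rfl | hlt
      · exact hqn
      · rw [hq D hlt]; exact zero_mem _
    have hA : A (l D) ∈ LinearMap.range B := by
      -- Here `D ≥ n ≥ 1`, so the coefficient of `λ ^ D` reads `A (l D) = q D + B (l (D - 1))`.
      obtain ⟨d, rfl⟩ : ∃ d, D = d + 1 := ⟨D - 1, by omega⟩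
      have h1 := congrFun hl (d + 1)
      rw [pencilMap_succ, sub_eq_iff_eq_add] at h1
      rw [h1]
      exact add_mem hqD (LinearMap.mem_range_self B _)
    obtain ⟨c, hc⟩ := hW _ hB hA
    -- The shift is legitimate because `e ≤ n ≤ D`; it places the top coefficient of `p` at index
    -- `D`.
    refine ih (l - c • shiftSeq (D - e) p) ?_ fun k hk => ?_
    · rw [map_sub, map_smul, pencilMap_shiftSeq_eq_zero A B _ hp, hl, smul_zero, sub_zero]
    · have hk' : ¬ k < D - e := by omega
      rcases hk.eq_or_lt with rfl | hlt
      · have : D - (D - e) = e := by omega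
        simp [shiftSeq, hc, this, hk']
      · simp [shiftSeq, hk', h k hlt, hpe (k - (D - e)) (by omega)]

/-- Extension of a finite sequence by zero. -/
def extendSeq (K : Type*) {V : Type*} [Field K] [AddCommGroup V] [Module K V] (n : ℕ) :
    (Fin n → V) →ₗ[K] (ℕ → V) where
  toFun l k := if h : k < n then l ⟨k, h⟩ else 0
  map_add' l m := by
    ext k
    by_cases h : k < n <;> simp [h]
  map_smul' c l := by
    ext k
    by_cases h : k < n <;> simp [h]

lemma extendSeq_of_lt {n k : ℕ} (h : k < n) (l : Fin n → V) :
    extendSeq K n l k = l ⟨k, h⟩ := dif_pos h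

lemma extendSeq_of_le {n k : ℕ} (h : n ≤ k) (l : Fin n → V) :
    extendSeq K n l k = 0 := dif_neg h.not_gt

lemma pencilMap_of_lt (A B : V →ₗ[K] U) {n k : ℕ} {l : ℕ → V} (hl : ∀ k, n ≤ k → l k = 0)
    (h : n < k) : pencilMap A B l k = 0 := by
  obtain ⟨k, rfl⟩ : ∃ d, k = d + 1 := ⟨k - 1, by omega⟩
  simp [hl (k + 1) (by omega), hl k (by omega)]

lemma pencilMap_self (A B : V →ₗ[K] U) {n : ℕ} {l : ℕ → V} (hl : ∀ k, n + 1 ≤ k → l k = 0) :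
    pencilMap A B l (n + 1) = -B (l n) := by
  simp [hl]

/-- The pencil acting on vector polynomials of degree at most `n`: the coefficients of
`1, …, λ ^ n` of the result, and the negative of the coefficient of `λ ^ (n + 1)`. -/
def truncatedPencilMap (A B : V →ₗ[K] U) (n : ℕ) :
    (Fin (n + 1) → V) →ₗ[K] (Fin (n + 1) → U) × LinearMap.range B :=
  ((LinearMap.funLeft K U Fin.val) ∘ₗ pencilMap A B ∘ₗ extendSeq K (n + 1)).prod
    (B.rangeRestrict ∘ₗ LinearMap.proj (Fin.last n))

lemma truncatedPencilMap_eq_iff (A B : V →ₗ[K] U) {n : ℕ} (l : Fin (n + 1) → V) (u : U) :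
    truncatedPencilMap A B n l = (Pi.single 0 u, 0) ↔
      pencilMap A B (extendSeq K (n + 1) l) = Pi.single 0 u := by
  have hz := fun k (hk : n + 1 ≤ k) => extendSeq_of_le (K := K) hk l
  have hlast : pencilMap A B (extendSeq K (n + 1) l) (n + 1) = -B (l (Fin.last n)) := by
    rw [pencilMap_self A B hz, extendSeq_of_lt (Nat.lt_succ_self n)]
    rfl
  have hs (k : Fin (n + 1)) : (Pi.single 0 u : ℕ → U) k = (Pi.single 0 u : Fin (n + 1) → U) k := by
    simp [Pi.single_apply]
  constructor
  · intro h
    ext k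
    rcases lt_trichotomy k (n + 1) with hk | rfl | hk
    · exact (congrFun (congrArg Prod.fst h) ⟨k, hk⟩).trans (hs ⟨k, hk⟩).symm
    · have h2 : B (l (Fin.last n)) = 0 := congrArg Subtype.val (congrArg Prod.snd h)
      rw [hlast, h2, neg_zero, Pi.single_eq_of_ne (Nat.succ_ne_zero n)]
    · rw [pencilMap_of_lt A B hz hk, Pi.single_eq_of_ne (by omega)]
  · intro h
    refine Prod.ext (funext fun k => (congrFun h k).trans (hs k)) (Subtype.ext ?_)
    have h1 := congrFun h (n + 1)
    rw [hlast, Pi.single_eq_of_ne (Nat.succ_ne_zero n), neg_eq_zero] at h1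
    exact h1

lemma top_coeff_mem (A B : V →ₗ[K] U) {p : ℕ → V} (hp : pencilMap A B p = 0) {e : ℕ}
    (hpe : ∀ k, e < k → p k = 0) : B (p e) = 0 ∧ A (p e) ∈ LinearMap.range B := by
  constructor
  · simpa [hpe] using congrFun hp (e + 1)
  · rcases e with _ | e
    · have h := congrFun hp 0
      simp only [pencilMap_zero, Pi.zero_apply] at h
      rw [h]; exact zero_mem _
    · have h := congrFun hp (e + 1)
      simp only [pencilMap_succ, Pi.zero_apply, sub_eq_zero] at h
      exact ⟨_, h.symm⟩

/-- The first projection of the kernel of `(a, b) ↦ (-B a, A a - B b)` has range `W = {x | Bx = 0,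
Ax ∈ range B}`. The pairs `(0, b)` with `B b = 0` lie in the kernel of this projection, so
rank-nullity leaves at most one dimension for `W`. -/
lemma exists_smul_of_finrank_ker [FiniteDimensional K V] (A B : V →ₗ[K] U)
    (h : Module.finrank K (LinearMap.ker
      (((-B).prod A).coprod ((0 : V →ₗ[K] U).prod (-B)))) ≤
        Module.finrank K (LinearMap.ker B) + 1)
    {w : V} (hw0 : w ≠ 0) (hwB : B w = 0) (hwA : A w ∈ LinearMap.range B)
    {x : V} (hxB : B x = 0) (hxA : A x ∈ LinearMap.range B) : ∃ c : K, x = c • w := by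
  set M := ((-B).prod A).coprod ((0 : V →ₗ[K] U).prod (-B)) with hM
  have memM (a b : V) : (a, b) ∈ LinearMap.ker M ↔ B a = 0 ∧ A a = B b := by
    simp [hM, LinearMap.mem_ker, Prod.ext_iff, ← sub_eq_add_neg, sub_eq_zero]
  let f : LinearMap.ker M →ₗ[K] V := LinearMap.fst K V V ∘ₗ (LinearMap.ker M).subtype
  have hker : Module.finrank K (LinearMap.ker B) ≤ Module.finrank K (LinearMap.ker f) := by
    let g : LinearMap.ker B →ₗ[K] LinearMap.ker f :=
      LinearMap.codRestrict _ (LinearMap.codRestrict _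
        (LinearMap.inr K V V ∘ₗ (LinearMap.ker B).subtype)
        fun b => (memM _ _).mpr ⟨map_zero B, by simp⟩) fun b => by
          exact LinearMap.mem_ker.mpr rfl
    refine LinearMap.finrank_le_finrank_of_injective (f := g) fun a b hab => ?_
    have := congrArg (fun z => (z : LinearMap.ker f).1.1.2) hab
    exact Subtype.ext this
  have hmem {z : V} (hzB : B z = 0) (hzA : A z ∈ LinearMap.range B) : z ∈ LinearMap.range f := by
    obtain ⟨y, hy⟩ := hzA
    exact ⟨⟨(z, y), (memM _ _).mpr ⟨hzB, hy.symm⟩⟩, rfl⟩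
  have hrank := LinearMap.finrank_range_add_finrank_ker f
  have hle : Module.finrank K (LinearMap.range f) ≤ 1 := by omega
  obtain ⟨v, hv⟩ := finrank_le_one_iff.mp hle
  obtain ⟨a, ha⟩ := hv ⟨w, hmem hwB hwA⟩
  obtain ⟨b, hb⟩ := hv ⟨x, hmem hxB hxA⟩
  have ha' : a • (v : V) = w := congrArg Subtype.val ha
  have hb' : b • (v : V) = x := congrArg Subtype.val hb
  have ha0 : a ≠ 0 := by
    rintro rfl
    exact hw0 (by rw [← ha', zero_smul])
  exact ⟨b * a⁻¹, by rw [← ha', ← hb', smul_smul, mul_assoc, inv_mul_cancel₀ ha0, mul_one]⟩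

variable [FiniteDimensional K V] [FiniteDimensional K U]

lemma exists_kernel_sequence (A B : V →ₗ[K] U) (hdim : Module.finrank K V = Module.finrank K U + 1)
    {n : ℕ} (hB : Module.finrank K (LinearMap.range B) = n) :
    ∃ (p : ℕ → V) (e : ℕ), e ≤ n ∧ p e ≠ 0 ∧ (∀ k, e < k → p k = 0) ∧ pencilMap A B p = 0 := by
  have hker : LinearMap.ker (truncatedPencilMap A B n) ≠ ⊥ := by
    -- With `m = dim U`, the source has dimension `(n + 1)(m + 1)` and the target `(n + 1)m + n`,
    -- one less.
    apply LinearMap.ker_ne_bot_of_finrank_lt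
    rw [Module.finrank_prod, Module.finrank_pi_fintype, Module.finrank_pi_fintype, hB]
    simp only [Finset.sum_const, Finset.card_univ, Fintype.card_fin, smul_eq_mul, hdim]
    nlinarith
  obtain ⟨l, hl, hl0⟩ := (Submodule.ne_bot_iff _).mp hker
  have hz := fun k (hk : n + 1 ≤ k) => extendSeq_of_le (K := K) hk l
  obtain ⟨j, hj⟩ := Function.ne_iff.mp hl0
  classical
  let e := Nat.findGreatest (fun k => extendSeq K (n + 1) l k ≠ 0) n
  refine ⟨extendSeq K (n + 1) l, e, Nat.findGreatest_le n, ?_, fun k hk => ?_,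
    by simpa using (truncatedPencilMap_eq_iff A B l 0).mp (by rw [Pi.single_zero]; exact hl)⟩
  · refine Nat.findGreatest_spec (P := fun k => extendSeq K (n + 1) l k ≠ 0)
      (Nat.lt_succ_iff.mp j.2) ?_
    rw [extendSeq_of_lt j.2]
    exact hj
  · by_cases hkn : k ≤ n
    · exact not_not.mp (Nat.findGreatest_is_greatest hk hkn)
    · exact hz k (by omega)

/-- If the pencil is onto vector polynomials, has one more column than rows, and satisfies the two
rank conditions, then its restriction to degree at most `n` is a bijection
onto the vector polynomials of degree at most `n + 1` whose leading coefficient lies in the range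
of `B`. -/
theorem pencilMap_bijective_of_rank (A B : V →ₗ[K] U)
    (hdim : Module.finrank K V = Module.finrank K U + 1)
    {n : ℕ} (hB : Module.finrank K (LinearMap.range B) = n + 1)
    (hAB : Module.finrank K (LinearMap.ker
      (((-B).prod A).coprod ((0 : V →ₗ[K] U).prod (-B)))) ≤
        Module.finrank K (LinearMap.ker B) + 1)
    (hsurj : ∀ (q : ℕ → U) (d : ℕ), (∀ k, d ≤ k → q k = 0) →
      ∃ (l : ℕ → V) (D : ℕ), pencilMap A B l = q ∧ ∀ k, D ≤ k → l k = 0) :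
    Function.Bijective (truncatedPencilMap A B n) := by
  obtain ⟨p, e, hen, hp0, hpe, hp⟩ := exists_kernel_sequence A B hdim hB
  obtain ⟨hpB, hpA⟩ := top_coeff_mem A B hp hpe
  have hs : Function.Surjective (truncatedPencilMap A B n) := by
    rintro ⟨q, u⟩
    -- The sign compensates for the second component of `truncatedPencilMap`, which is minus the
    -- coefficient of `λ ^ (n + 1)`.
    let Q : ℕ → U := fun k => if k = n + 1 then -(u : U) else extendSeq K (n + 1) q k
    have hQ (k : ℕ) (hk : n + 1 < k) : Q k = 0 := by
      simp [Q, hk.ne', extendSeq_of_le hk.le]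
    have hQn : Q (n + 1) = -(u : U) := if_pos rfl
    obtain ⟨l, D, hl, hD⟩ := hsurj Q (n + 2) hQ
    -- The reduction is applied with bound `n + 1`, so the new solution has degree at most `n`.
    obtain ⟨l', hl', hz⟩ := exists_pencilMap_eq_of_degree_bound A B (Nat.le_add_left 1 n) hen hp hpe
      (fun x hxB hxA => exists_smul_of_finrank_ker A B hAB hp0 hpB hpA hxB hxA) hQ
      (by rw [hQn]; exact neg_mem u.2) D l hl hD
    have hext : extendSeq K (n + 1) (fun k : Fin (n + 1) => l' k) = l' := by
      ext k
      rcases Nat.lt_or_ge k (n + 1) with h | h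
      · rw [extendSeq_of_lt h]
      · rw [extendSeq_of_le h, hz k h]
    refine ⟨fun k => l' k, Prod.ext (funext fun k => ?_) (Subtype.ext ?_)⟩
    · change pencilMap A B (extendSeq K (n + 1) fun k : Fin (n + 1) => l' k) k = q k
      rw [hext, hl']
      simp [Q, k.2.ne, extendSeq_of_lt k.2]
    · change B (l' n) = u
      have h1 := congrFun hl' (n + 1)
      rw [pencilMap_self A B hz, hQn] at h1
      exact neg_injective h1
  refine ⟨(LinearMap.injective_iff_surjective_of_finrank_eq_finrank ?_).mpr hs, hs⟩
  rw [Module.finrank_prod, Module.finrank_pi_fintype, Module.finrank_pi_fintype, hB]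
  simp only [Finset.sum_const, Finset.card_univ, Fintype.card_fin, smul_eq_mul, hdim]
  ring

end Sequences

/-! ### Translation between block matrices, polynomial matrices and coefficient sequences. -/

section Matrices

variable {r : ℕ} (A B : Matrix (Fin r) (Fin (r + 1)) ℂ)

lemma exists_pencilMap_eq_of_hasPolynomialLeftInverse
    (hinv : HasPolynomialLeftInverse (pencil A B)) (q : ℕ → Fin r → ℂ) (d : ℕ)
    (hq : ∀ k, d ≤ k → q k = 0) :
    ∃ (l : ℕ → Fin (r + 1) → ℂ) (D : ℕ),
      pencilMap A.mulVecLin B.mulVecLin l = q ∧ ∀ k, D ≤ k → l k = 0 := by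
  obtain ⟨L, hL⟩ := hinv
  let Q : Fin r → ℂ[X] := fun a => ∑ k ∈ Finset.range d, C (q k a) * X ^ k
  have hQ (a : Fin r) (k : ℕ) : (Q a).coeff k = q k a := by
    simp only [Q, finsetSum_coeff, coeff_C_mul, coeff_X_pow, mul_ite, mul_one, mul_zero,
      Finset.sum_ite_eq, Finset.mem_range]
    split_ifs with h
    · rfl
    · rw [hq k (by omega)]; rfl
  -- Transposing `L * (Aᵀ - λBᵀ) = 1` makes `Lᵀ` a right inverse of `A - λB`, so `Lᵀ Q` is a
  -- preimage of `Q`.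
  let P : Fin (r + 1) → ℂ[X] := L.transpose.mulVec Q
  have hP : (A.map C - (X : ℂ[X]) • B.map C).mulVec P = Q := by
    have h1 : (A.map C - (X : ℂ[X]) • B.map C) * L.transpose = 1 := by
      have := congrArg Matrix.transpose hL
      rw [Matrix.transpose_mul, Matrix.transpose_one] at this
      rw [← this]
      congr 1
    rw [Matrix.mulVec_mulVec, h1, Matrix.one_mulVec]
  refine ⟨fun k b => (P b).coeff k, (Finset.univ.sup fun b => (P b).natDegree) + 1, ?_,
    fun k hk => ?_⟩
  · ext k a
    rw [← hQ, ← hP]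
    rcases k with _ | k
    · simp [Matrix.mulVec, dotProduct, sub_mul, mul_assoc]
    · simp [Matrix.mulVec, dotProduct, sub_mul, mul_assoc, Finset.sum_sub_distrib]
  · ext b
    refine coeff_eq_zero_of_natDegree_lt (lt_of_lt_of_le (Nat.lt_succ_of_le ?_) hk)
    exact Finset.le_sup (f := fun b => (P b).natDegree) (Finset.mem_univ b)

/-- The coefficient sequence `ℓ^0, ℓ^1, …` of a stacked vector. -/
noncomputable def coeffSeq {N : ℕ} (x : Fin (N - 1) × Fin (r + 1) → ℂ) : ℕ → Fin (r + 1) → ℂ :=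
  extendSeq ℂ (N - 1) (coeffBlock x)

lemma sum_ite_eq_extendSeq {m k : ℕ} (M : Matrix (Fin r) (Fin (r + 1)) ℂ) (a : Fin r)
    (l : Fin m → Fin (r + 1) → ℂ) :
    ∑ q : Fin m, (if k = (q : ℕ) then M.mulVec (l q) a else 0) =
      M.mulVec (extendSeq ℂ m l k) a := by
  rcases Nat.lt_or_ge k m with h | h
  · rw [extendSeq_of_lt h, Finset.sum_eq_single ⟨k, h⟩]
    · simp
    · exact fun b _ hb => if_neg fun e => hb (Fin.ext e.symm)
    · simp
  · rw [extendSeq_of_le h, Matrix.mulVec_zero]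
    exact Finset.sum_eq_zero fun q _ => if_neg (q.2.trans_le h).ne'

/-- The blocks of `x` are stacked by decreasing degree. Reversing rows and columns therefore makes
block row `k` the coefficient of `λ ^ k`. -/
lemma blockMatrix_mulVec {n : ℕ} (x : Fin (n + 2 - 1) × Fin (r + 1) → ℂ)
    (k : Fin (n + 2)) (a : Fin r) :
    (blockMatrix (n + 2) A B).mulVec x (k.rev, a) =
      pencilMap A.mulVecLin B.mulVecLin (coeffSeq x) k a := by
  have key (q : Fin (n + 2 - 1)) :
      ∑ b, blockMatrix (n + 2) A B (k.rev, a) (q.rev, b) * x (q.rev, b) =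
        (if (k : ℕ) = q then A.mulVec (coeffBlock x q) a else 0) -
          (if (k : ℕ) = q + 1 then B.mulVec (coeffBlock x q) a else 0) := by
    have hq := q.2
    have hk := k.2
    have h1 : ((k.rev : ℕ) = q.rev) ↔ (k : ℕ) = q + 1 := by
      rw [Fin.val_rev, Fin.val_rev]; omega
    have h2 : ((k.rev : ℕ) = q.rev + 1) ↔ (k : ℕ) = q := by
      rw [Fin.val_rev, Fin.val_rev]; omega
    simp only [blockMatrix, Matrix.of_apply, h1, h2]
    by_cases e1 : (k : ℕ) = q + 1
    · simp [e1, Matrix.mulVec, dotProduct, coeffBlock]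
    · by_cases e2 : (k : ℕ) = q <;> simp [e1, e2, Matrix.mulVec, dotProduct, coeffBlock]
  have h : (blockMatrix (n + 2) A B).mulVec x (k.rev, a) =
      ∑ q : Fin (n + 2 - 1), ((if (k : ℕ) = q then A.mulVec (coeffBlock x q) a else 0) -
          (if (k : ℕ) = q + 1 then B.mulVec (coeffBlock x q) a else 0)) := by
    rw [Matrix.mulVec, dotProduct, Fintype.sum_prod_type,
      ← Equiv.sum_comp (Fin.revPerm : Equiv.Perm (Fin (n + 2 - 1)))]
    exact Finset.sum_congr rfl fun q _ => key q
  rw [h, Finset.sum_sub_distrib, sum_ite_eq_extendSeq]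
  obtain ⟨k, hk⟩ := k
  rcases k with _ | k
  · simp [coeffSeq]
  · simp only [Nat.add_right_cancel_iff, sum_ite_eq_extendSeq, pencilMap_succ, coeffSeq,
      Matrix.mulVecLin_apply, Pi.sub_apply]

lemma blockMatrix_mulVec_eq_iff {n : ℕ} (x : Fin (n + 2 - 1) × Fin (r + 1) → ℂ) (i : Fin r) :
    (blockMatrix (n + 2) A B).mulVec x = blockRhs (n + 2) i ↔
      pencilMap A.mulVecLin B.mulVecLin (coeffSeq x) = Pi.single 0 (Pi.single i 1) := by
  have hrhs (k : Fin (n + 2)) (a : Fin r) : blockRhs (n + 2) i (k.rev, a) =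
      (Pi.single 0 (Pi.single i 1) : ℕ → Fin r → ℂ) k a := by
    have hk := k.2
    have e : (k.rev : ℕ) = n + 2 - 1 ↔ (k : ℕ) = 0 := by rw [Fin.val_rev]; omega
    simp only [blockRhs, e]
    split_ifs with h
    · simp [h, Matrix.one_apply, Pi.single_apply]
    · simp [h]
  constructor
  · intro h
    ext k a
    rcases Nat.lt_or_ge k (n + 2) with hk | hk
    · have h1 := congrFun h ((⟨k, hk⟩ : Fin (n + 2)).rev, a)
      rwa [blockMatrix_mulVec, hrhs] at h1
    · rw [pencilMap_of_lt _ _ (n := n + 1) (l := coeffSeq x)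
        (fun k hk => extendSeq_of_le hk _) hk,
        Pi.single_eq_of_ne (by omega)]
  · intro h
    ext ⟨j, a⟩
    rw [← Fin.rev_rev j, blockMatrix_mulVec, hrhs, h]

/-- Stacking `(y, z)` into one vector embeds the first kernel into the second; only this upper bound
is needed. -/
lemma finrank_ker_coprod_le :
    Module.finrank ℂ (LinearMap.ker (((-B.mulVecLin).prod A.mulVecLin).coprod
      ((0 : (Fin (r + 1) → ℂ) →ₗ[ℂ] (Fin r → ℂ)).prod (-B.mulVecLin)))) ≤
    Module.finrank ℂ (LinearMap.ker (Matrix.fromBlocks (-B) 0 A (-B)).mulVecLin) := by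
  set M := ((-B.mulVecLin).prod A.mulVecLin).coprod
      ((0 : (Fin (r + 1) → ℂ) →ₗ[ℂ] (Fin r → ℂ)).prod (-B.mulVecLin)) with hM
  let e := (LinearEquiv.sumArrowLequivProdArrow (Fin (r + 1)) (Fin (r + 1)) ℂ ℂ).symm
  let g : LinearMap.ker M →ₗ[ℂ] LinearMap.ker (Matrix.fromBlocks (-B) 0 A (-B)).mulVecLin :=
    LinearMap.codRestrict _ (e.toLinearMap ∘ₗ (LinearMap.ker M).subtype) <| by
      rintro ⟨⟨y, z⟩, h⟩
      rw [LinearMap.mem_ker] at h ⊢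
      have h1 : -B.mulVec y = 0 := by simpa [hM] using congrArg Prod.fst h
      have h2 : A.mulVec y - B.mulVec z = 0 := by
        simpa [hM, sub_eq_add_neg] using congrArg Prod.snd h
      have he : e (y, z) = Sum.elim y z := rfl
      change (Matrix.fromBlocks (-B) 0 A (-B)).mulVec (e (y, z)) = 0
      rw [he, Matrix.fromBlocks_mulVec]
      ext (a | a)
      · simpa [Matrix.neg_mulVec] using congrFun h1 a
      · simpa [Matrix.neg_mulVec, sub_eq_add_neg] using congrFun h2 a
  refine LinearMap.finrank_le_finrank_of_injective (f := g) fun a b hab => ?_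
  exact Subtype.ext (e.injective (congrArg Subtype.val hab))

lemma coeff_polyMatrix {N : ℕ} (x : Fin r → Fin (N - 1) × Fin (r + 1) → ℂ) (b : Fin (r + 1))
    (i : Fin r) (k : ℕ) : (polyMatrix x b i).coeff k = coeffSeq (x i) k b := by
  simp only [polyMatrix, Matrix.of_apply, finsetSum_coeff, coeff_C_mul, coeff_X_pow, mul_ite,
    mul_one, mul_zero, coeffSeq]
  rcases Nat.lt_or_ge k (N - 1) with h | h
  · rw [extendSeq_of_lt h, Finset.sum_eq_single ⟨k, h⟩]
    · simp
    · exact fun b _ hb => if_neg fun e => hb (Fin.ext e.symm)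
    · simp
  · rw [extendSeq_of_le h]
    exact Finset.sum_eq_zero fun q _ => if_neg (q.2.trans_le h).ne'

lemma coeff_transpose_polyMatrix_mul_pencil {N : ℕ} (x : Fin r → Fin (N - 1) × Fin (r + 1) → ℂ)
    (i a : Fin r) (k : ℕ) : (((polyMatrix x).transpose * pencil A B) i a).coeff k =
      pencilMap A.mulVecLin B.mulVecLin (coeffSeq (x i)) k a := by
  rcases k with _ | k
  · have h (b : Fin (r + 1)) : (polyMatrix x b i * (pencil A B b a)).coeff 0 =
        A a b * coeffSeq (x i) 0 b := by
      simp [pencil, mul_coeff_zero, coeff_polyMatrix, mul_comm (A a b)]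
    simp only [Matrix.mul_apply, Matrix.transpose_apply, finsetSum_coeff, h, pencilMap_zero,
      Matrix.mulVecLin_apply, Matrix.mulVec, dotProduct]
  · have h (b : Fin (r + 1)) : (polyMatrix x b i * (pencil A B b a)).coeff (k + 1) =
        A a b * coeffSeq (x i) (k + 1) b - B a b * coeffSeq (x i) k b := by
      have : polyMatrix x b i * pencil A B b a =
          polyMatrix x b i * C (A a b) - polyMatrix x b i * C (B a b) * X := by
        simp only [pencil, Matrix.sub_apply, Matrix.smul_apply, Matrix.map_apply,
          Matrix.transpose_apply, smul_eq_mul]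
        ring
      rw [this, coeff_sub, coeff_mul_X, coeff_mul_C, coeff_mul_C, coeff_polyMatrix,
        coeff_polyMatrix, mul_comm, mul_comm (B a b)]
    simp only [Matrix.mul_apply, Matrix.transpose_apply, finsetSum_coeff, h, pencilMap_succ,
      Finset.sum_sub_distrib, Pi.sub_apply, Matrix.mulVecLin_apply, Matrix.mulVec, dotProduct]

end Matrices

end PencilLeftInverse

open PencilLeftInverse

theorem mainTheorem4 (r N : ℕ) (hN : 2 ≤ N) (hNr : N ≤ r)
    (A B : Matrix (Fin r) (Fin (r + 1)) ℂ)
    (hinv : PencilLeftInverse.HasPolynomialLeftInverse (PencilLeftInverse.pencil A B))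
    (hA : A.transpose.rank = r)
    (hB : B.transpose.rank = N - 1)
    (hAB : (Matrix.fromBlocks (-B) 0 A (-B)).rank = r + N - 1) :
    (∀ i : Fin r, ∃! x : Fin (N - 1) × Fin (r + 1) → ℂ,
      (PencilLeftInverse.blockMatrix N A B).mulVec x = PencilLeftInverse.blockRhs N i) ∧
    ∀ x : Fin r → Fin (N - 1) × Fin (r + 1) → ℂ,
      (∀ i : Fin r,
        (PencilLeftInverse.blockMatrix N A B).mulVec (x i) = PencilLeftInverse.blockRhs N i) →
      (∀ b i, (PencilLeftInverse.polyMatrix x b i).natDegree ≤ N - 2) ∧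
      (PencilLeftInverse.polyMatrix x).transpose * PencilLeftInverse.pencil A B = 1 := by
  obtain ⟨n, rfl⟩ : ∃ n, N = n + 2 := ⟨N - 2, by omega⟩
  have hBr : Module.finrank ℂ (LinearMap.range B.mulVecLin) = n + 1 := by
    rw [Matrix.rank_transpose] at hB
    exact hB
  have hker : Module.finrank ℂ (LinearMap.ker (((-B.mulVecLin).prod A.mulVecLin).coprod
      ((0 : (Fin (r + 1) → ℂ) →ₗ[ℂ] (Fin r → ℂ)).prod (-B.mulVecLin)))) ≤
        Module.finrank ℂ (LinearMap.ker B.mulVecLin) + 1 := by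
    -- The block matrix has nullity `2(r + 1) - (r + N - 1) = r - N + 3`, one more than the nullity
    -- `r + 1 - (N - 1)` of `B`.
    refine (finrank_ker_coprod_le A B).trans ?_
    have h1 := LinearMap.finrank_range_add_finrank_ker
      (Matrix.fromBlocks (-B) 0 A (-B)).mulVecLin
    have h2 := LinearMap.finrank_range_add_finrank_ker B.mulVecLin
    change (Matrix.fromBlocks (-B) 0 A (-B)).rank + _ = _ at h1
    simp only [Module.finrank_fintype_fun_eq_card, Fintype.card_sum, Fintype.card_fin] at h1 h2
    omega
  have hbij := pencilMap_bijective_of_rank A.mulVecLin B.mulVecLin (by simp) hBr hker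
    (exists_pencilMap_eq_of_hasPolynomialLeftInverse A B hinv)
  have hiff (x : Fin (n + 2 - 1) × Fin (r + 1) → ℂ) (i : Fin r) :
      (blockMatrix (n + 2) A B).mulVec x = blockRhs (n + 2) i ↔
        truncatedPencilMap A.mulVecLin B.mulVecLin n (coeffBlock x) =
          (Pi.single 0 (Pi.single i 1), 0) :=
    (blockMatrix_mulVec_eq_iff A B x i).trans
      (truncatedPencilMap_eq_iff A.mulVecLin B.mulVecLin (coeffBlock x) (Pi.single i 1)).symm
  refine ⟨fun i => ?_, fun x hx => ⟨fun b i => ?_, ?_⟩⟩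
  · obtain ⟨l, hl⟩ := hbij.2 (Pi.single 0 (Pi.single i 1), 0)
    have hcb : coeffBlock (N := n + 2) (fun q => l q.1.rev q.2) = l := by
      ext k b
      exact congrArg (fun j => l j b) (Fin.rev_rev k)
    refine ⟨fun q => l q.1.rev q.2, (hiff _ i).mpr (by rw [hcb, hl]), fun y hy => ?_⟩
    have hy' : coeffBlock y = l := hbij.1 (((hiff y i).mp hy).trans hl.symm)
    ext ⟨q, b⟩
    rw [← hy']
    exact congrArg (fun j => y (j, b)) (Fin.rev_rev q).symm
  · rw [natDegree_le_iff_coeff_eq_zero]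
    intro k hk
    rw [coeff_polyMatrix, coeffSeq, extendSeq_of_le (by omega)]
    rfl
  · ext i a k
    rw [coeff_transpose_polyMatrix_mul_pencil, (blockMatrix_mulVec_eq_iff A B (x i) i).mp (hx i)]
    by_cases hia : i = a
    · subst hia
      by_cases hk : k = 0 <;> simp [hk, coeff_one]
    · by_cases hk : k = 0 <;> simp [hk, hia, Ne.symm hia]
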